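/- Let $\mathrm{Hol}$ be the $\mathbb{C}$-algebra of holomorphic functions on the upper half plane and let $H=\bigoplus_{n\in\mathbb{R}}H_n$ with $H_n=\mathrm{Hol}$; the element of $H_n$ given by $f\in\mathrm{Hol}$ is written $(f,n)$, and $H$ is a graded $\mathbb{C}$-algebra with product $(f,n)(g,m)=(fg,n+m)$ and identity $(1,0)$. Let $E_2,E_4,E_6$ be the Eisenstein series for $\mathrm{SL}(2,\mathbb{Z})$ normalized to have constant term $1$, and define $\mathbb{C}$-linear endomorphisms of $H$ by $$\delta(f,n)=\Bigl(\tfrac{1}{2\pi i}\tfrac{df}{dz}-\tfrac{n}{12}E_2f,\;n+2\Bigr),\qquad e_4(f,n)=(E_4f,n+4),\qquad e_6(f,n)=(E_6f,n+6).$$ Let $\mathcal{R}$ be the $\mathbb{C}$-subalgebra of $\mathrm{End}_{\mathbb{C}}(H)$ generated by $\delta,e_4,e_6$, and for $k\in\mathbb{Z}$ let $\mathcal{R}_k$ be the set of $a\in\mathcal{R}$ with $a(H_n)\subset H_{n+k}$ for all $n\in\mathbb{R}$. An element of $\mathcal{R}$ is called monic if it has the form $\delta^n+a_{n-1}\delta^{n-1}+\cdots+a_1\delta+a_0$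 with $n\ge 0$ and all $a_i$ in the subalgebra $\mathbb{C}[e_4,e_6]$ generated by $e_4$ and $e_6$ (the algebra of modular forms for $\mathrm{SL}(2,\mathbb{Z})$ acting by multiplication). For $k\in\mathbb{R}$ put $$S_k=\{\phi\in H_k\mid a\phi=0\text{ for some monic }a\in\mathcal{R}\},$$ the set of weight-$k$ solutions of monic modular linear differential equations. For $k\in\mathbb{Z}$ let $\mathcal{M}_k\subset H_k$ be the space of all $(f,k)$ with $f$ a holomorphic modular form of weight $k$ for $\mathrm{SL}(2,\mathbb{Z})$. Theorem. 1. $S_k+S_k\subset S_k$ for all $k\in\mathbb{R}$. 2. $S_kS_l\subset S_{k+l}$ for all $k,l\in\mathbb{R}$. 3. $\mathcal{R}_kS_l\subset S_{k+l}$ for all $k\in\mathbb{Z}$ and $l\in\mathbb{R}$. 4. $\mathcal{M}_k\subset S_k$ for all $k\in\mathbb{Z}$. Moreover, $\bigoplus_{k\in\mathbb{R}}S_k\subset H$ (the set of elements of $H$ whose component in $H_k$ lies in $S_k$ for every $k\in\mathbb{R}$) is a $\mathbb{C}$-subalgebra and a left $\mathcal{R}$-submodule of $H$. -/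

import Mathlib

open scoped Manifold MatrixGroups ModularForm Pointwise UpperHalfPlane

noncomputable section

namespace MLDO

/-- The `ℂ`-algebra `Hol` of holomorphic functions on the upper half plane. -/
def Hol : Subalgebra ℂ (ℍ → ℂ) where
  carrier := {f | MDifferentiable 𝓘(ℂ) 𝓘(ℂ) f}
  mul_mem' hf hg := hf.mul hg
  add_mem' hf hg := hf.add hg
  algebraMap_mem' _ := mdifferentiable_const

/-- The Ramanujan-Serre operator `D_k f = (2πi)⁻¹ df/dz - (k/12) E₂ f` of weight `k`,
as a `ℂ`-linear endomorphism of `Hol`. -/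
def serreD (k : ℝ) : Hol →ₗ[ℂ] Hol where
  toFun f := ⟨Derivative.serreDerivative (k : ℂ) f.1,
    Derivative.serreDerivative_mdifferentiable _ f.2⟩
  map_add' f g := Subtype.ext (Derivative.serreDerivative_add _ _ _ f.2 g.2)
  map_smul' c f := Subtype.ext (Derivative.serreDerivative_smul _ c _ f.2)

/-- The algebra `H = ⨁_{n ∈ ℝ} H_n` with `H_n = Hol` and `(f, n) (g, m) = (f g, n + m)`. -/
abbrev H : Type := AddMonoidAlgebra Hol ℝ

/-- The homogeneous element `(f, n)` of weight `n`. -/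
abbrev hom (f : Hol) (n : ℝ) : H := AddMonoidAlgebra.single n f

/-- The homogeneous component `H_n` of weight `n`. -/
def degH (n : ℝ) : Set H := Set.range fun f : Hol => hom f n

/-- The holomorphic function underlying a modular form of weight `k` for `SL(2, ℤ)`. -/
def ofModularForm {k : ℤ} (f : ModularForm 𝒮ℒ k) : Hol := ⟨f, f.holo'⟩

/-- The derivation `δ (f, n) = (D_n f, n + 2)` of `H`. -/
def delta : Module.End ℂ H where
  toFun φ := φ.coeff.sum fun n f => hom (serreD n f) (n + 2)
  map_add' φ ψ := by
    rw [AddMonoidAlgebra.coeff_add]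
    exact Finsupp.sum_add_index' (by simp) (by intro n f g; simp)
  map_smul' c φ := by
    rw [AddMonoidAlgebra.coeff_smul, Finsupp.sum_smul_index' (by simp)]
    simp [Finsupp.smul_sum, AddMonoidAlgebra.smul_single]

theorem delta_hom (f : Hol) (n : ℝ) : delta (hom f n) = hom (serreD n f) (n + 2) := by
  simp [delta]

/-- Multiplication by the Eisenstein series of weight four: `e₄ (f, n) = (E₄ f, n + 4)`. -/
def e4 : Module.End ℂ H := LinearMap.mulLeft ℂ (hom (ofModularForm ModularForm.E₄) 4)

/-- Multiplication by the Eisenstein series of weight six: `e₆ (f, n) = (E₆ f, n + 6)`. -/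
def e6 : Module.End ℂ H := LinearMap.mulLeft ℂ (hom (ofModularForm ModularForm.E₆) 6)

theorem e4_hom (f : Hol) (n : ℝ) :
    e4 (hom f n) = hom (ofModularForm ModularForm.E₄ * f) (n + 4) := by
  simp [e4, AddMonoidAlgebra.single_mul_single, add_comm]

theorem e6_hom (f : Hol) (n : ℝ) :
    e6 (hom f n) = hom (ofModularForm ModularForm.E₆ * f) (n + 6) := by
  simp [e6, AddMonoidAlgebra.single_mul_single, add_comm]

/-- The algebra `𝓡` of modular linear differential operators. -/
def R : Subalgebra ℂ (Module.End ℂ H) := Algebra.adjoin ℂ {delta, e4, e6}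

/-- The homogeneous operators in `𝓡` of weight `k`: those that map `H_n` into `H_{n+k}`. -/
def degR (k : ℤ) : Set (Module.End ℂ H) :=
  {a | a ∈ R ∧ ∀ n : ℝ, ∀ φ ∈ degH n, a φ ∈ degH (n + k)}

/-- The algebra `ℂ[E₄, E₆]` of modular forms, acting on `H` by multiplication. -/
def coeffAlg : Subalgebra ℂ (Module.End ℂ H) := Algebra.adjoin ℂ {e4, e6}

/-- The space `𝓜_k ⊆ H_k` of holomorphic modular forms of weight `k` for `SL(2, ℤ)`. -/
def modularForms (k : ℤ) : Set H :=
  Set.range fun f : ModularForm 𝒮ℒ k => hom (ofModularForm f) k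

/-- The monic operators: `a = δ^n + a_{n-1} δ^{n-1} + ⋯ + a_1 δ + a_0` with `n ≥ 0` and
coefficients `a_i` in `ℂ[E₄, E₆]`. -/
def IsMonic (a : Module.End ℂ H) : Prop :=
  ∃ (n : ℕ) (c : Fin n → coeffAlg),
    a = delta ^ n + ∑ i : Fin n, (c i : Module.End ℂ H) * delta ^ (i : ℕ)

/-- The solutions `S_k ⊆ H_k` of weight `k` of the monic modular linear differential equations. -/
def S (k : ℝ) : Set H := {φ | φ ∈ degH k ∧ ∃ a ∈ R, IsMonic a ∧ a φ = 0}

/-- The direct sum `⨁_{k ∈ ℝ} S_k`: the elements of `H` all of whose components `(φ_k, k)`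
lie in `S_k`. -/
def sumS : Set H := {φ | ∀ k : ℝ, hom (φ.coeff k) k ∈ S k}

end MLDO

end

noncomputable section

namespace MLDO

open UpperHalfPlane ModularForm

/-! A weight-`k` element solves a monic equation exactly when it lies in a finitely generated
`formAlg`-submodule of `H` stable under `delta` (`mem_S_iff`), the differential analogue of
integrality. Two facts support this: `delta` is a derivation preserving `formAlg` (`delta_mul`,
`delta_mem_formAlg`), and `formAlg` is Noetherian, being finitely generated over `ℂ`. Sums and
products of such submodules are again of this kind, and each is already stable under `R`, so the
closure properties follow without manipulating equations. -/

/-! ### Level one modular forms are polynomials in `E₄` and `E₆`. -/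

/-- The subalgebra `ℂ[E₄, E₆]` of `H`. -/
def formAlg : Subalgebra ℂ H :=
  Algebra.adjoin ℂ {hom (ofModularForm E₄) 4, hom (ofModularForm E₆) 6}

theorem hom_E₄_mem : hom (ofModularForm E₄) 4 ∈ formAlg := Algebra.subset_adjoin (by simp)

theorem hom_E₆_mem : hom (ofModularForm E₆) 6 ∈ formAlg := Algebra.subset_adjoin (by simp)

theorem hom_mul_hom (f g : Hol) (m n : ℝ) : hom f m * hom g n = hom (f * g) (m + n) :=
  AddMonoidAlgebra.single_mul_single ..

theorem hom_add (f g : Hol) (n : ℝ) : hom (f + g) n = hom f n + hom g n :=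
  AddMonoidAlgebra.single_add ..

theorem smul_hom (c : ℂ) (f : Hol) (n : ℝ) : c • hom f n = hom (c • f) n :=
  AddMonoidAlgebra.smul_single ..

theorem algebraMap_eq_hom (c : ℂ) : algebraMap ℂ H c = hom (algebraMap ℂ Hol c) 0 := rfl

theorem hom_discriminant_mem :
    hom (ofModularForm (CuspForm.toModularFormₗ CuspForm.discriminant)) 12 ∈ formAlg := by
  have h : hom (ofModularForm (CuspForm.toModularFormₗ CuspForm.discriminant)) 12 =
      (1 / 1728 : ℂ) • hom (ofModularForm E₄) 4 ^ 3 +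
        (-1 / 1728 : ℂ) • hom (ofModularForm E₆) 6 ^ 2 := by
    rw [AddMonoidAlgebra.single_pow, AddMonoidAlgebra.single_pow, smul_hom, smul_hom,
      show (3 • 4 : ℝ) = 12 by norm_num, show (2 • 6 : ℝ) = 12 by norm_num, ← hom_add]
    congr 1
    refine Subtype.ext (funext fun z => ?_)
    change ModularForm.discriminant z = (1 / 1728 : ℂ) * E₄ z ^ 3 + (-1 / 1728 : ℂ) * E₆ z ^ 2
    rw [discriminant_eq_E₄_cube_sub_E₆_sq]
    ring
  rw [h]
  exact add_mem (formAlg.smul_mem (pow_mem hom_E₄_mem _) _)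
    (formAlg.smul_mem (pow_mem hom_E₆_mem _) _)

/-- These forms serve to remove constant terms in every even weight from 4 on. They are `E₄ ^ j` and
`E₄ ^ j * E₆`. -/
theorem exists_normalized_mem (m : ℕ) : ∀ k : ℤ, k = 2 * m + 4 → ∃ g : ModularForm 𝒮ℒ k,
    (qExpansion 1 g).coeff 0 = 1 ∧ hom (ofModularForm g) k ∈ formAlg := by
  induction m using Nat.twoStepInduction with
  | zero =>
    rintro _ rfl
    exact ⟨E₄, EisensteinSeries.E_qExpansion_coeff_zero _ ⟨2, rfl⟩, by simpa using hom_E₄_mem⟩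
  | one =>
    rintro _ rfl
    exact ⟨E₆, EisensteinSeries.E_qExpansion_coeff_zero _ ⟨3, rfl⟩, by simpa using hom_E₆_mem⟩
  | more m ih _ =>
    intro k hk
    obtain ⟨g, hg, hgm⟩ := ih (k - 4) (by push_cast at hk; lia)
    refine ⟨mcast (by ring) (E₄.mul g), ?_, ?_⟩
    · change (qExpansion 1 (E₄.mul g)).coeff 0 = 1
      rw [ModularForm.qExpansion_mul one_pos one_mem_strictPeriods_SL]
      have h4 : (qExpansion 1 E₄).coeff 0 = 1 := EisensteinSeries.E_qExpansion_coeff_zero _ ⟨2, rfl⟩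
      rw [PowerSeries.coeff_mul]
      simp [-PowerSeries.coeff_zero_eq_constantCoeff, h4, hg]
    · convert mul_mem hom_E₄_mem hgm
      rw [hom_mul_hom]
      congr 1
      push_cast
      ring

theorem hom_mem_formAlg {k : ℤ} (f : ModularForm 𝒮ℒ k) : hom (ofModularForm f) k ∈ formAlg := by
  -- Weights may be negative, so the induction runs over a natural strict upper bound of `k`;
  -- splitting off the discriminant lowers the weight by 12.
  obtain ⟨n, hn⟩ : ∃ n : ℕ, k < n := ⟨k.toNat + 1, by lia⟩
  induction n using Nat.strong_induction_on generalizing k with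
  | _ n ih =>
    have hz (h : f = 0) : hom (ofModularForm f) k ∈ formAlg := by
      subst h
      convert zero_mem formAlg
      exact AddMonoidAlgebra.single_zero _
    by_cases hneg : k < 0
    · exact hz (rank_zero_iff_forall_zero.mp (levelOne_neg_weight_rank_zero hneg) f)
    rcases Int.even_or_odd k with hev | hodd
    swap
    · exact hz (levelOne_odd_weight_eq_zero hodd f)
    by_cases h0 : k = 0
    · subst h0
      obtain ⟨c, hc⟩ := ModularFormClass.levelOne_weight_zero_const f
      convert formAlg.algebraMap_mem c
      rw [algebraMap_eq_hom, Int.cast_zero]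
      congr 1
      exact Subtype.ext hc
    by_cases h2 : k = 2
    · subst h2
      exact hz (rank_zero_iff_forall_zero.mp levelOne_weight_two_rank_zero f)
    obtain ⟨g, hg, hgm⟩ := exists_normalized_mem ((k - 4) / 2).toNat k (by
      obtain ⟨r, hr⟩ := hev
      lia)
    obtain ⟨h, hh⟩ := sub_smul_isCuspForm f g hg
    have key : hom (ofModularForm f) k = (qExpansion 1 f).coeff 0 • hom (ofModularForm g) k +
        hom (ofModularForm (CuspForm.toModularFormₗ CuspForm.discriminant)) 12 *
          hom (ofModularForm (CuspForm.discriminantEquiv h)) ((k - 12 : ℤ) : ℝ) := by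
      rw [hom_mul_hom, smul_hom, show (12 : ℝ) + ((k - 12 : ℤ) : ℝ) = k by push_cast; ring,
        ← hom_add]
      congr 1
      refine Subtype.ext (funext fun z => ?_)
      have h1 : h z = f z - (qExpansion 1 f).coeff 0 * g z := DFunLike.congr_fun hh z
      have h3 := discriminant_mul_discriminantEquiv_apply h z
      change f z = (qExpansion 1 f).coeff 0 * g z +
        ModularForm.discriminant z * CuspForm.discriminantEquiv h z
      rw [h3, h1]
      ring
    rw [key]
    exact add_mem (formAlg.smul_mem hgm _) (mul_mem hom_discriminant_mem
      (ih (n - 1) (by lia) _ (by lia)))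

/-! ### The Serre derivative preserves modular forms. -/

theorem isBoundedAtImInfty_normalizedDeriv {f : ℍ → ℂ} (hf : MDifferentiable 𝓘(ℂ) 𝓘(ℂ) f)
    (hb : IsBoundedAtImInfty f) :
    IsBoundedAtImInfty (Derivative.normalizedDerivOfComplex f) := by
  rw [isBoundedAtImInfty_iff] at hb ⊢
  obtain ⟨M, A, hA⟩ := hb
  -- Cauchy's estimate on the unit disc around `z`: the margin 2 keeps the closed disc inside both
  -- `Im > 0` and `Im > A`.
  refine ⟨‖(2 * Real.pi * Complex.I : ℂ)⁻¹‖ * M, max A 0 + 2, fun z hz => ?_⟩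
  rw [Derivative.normalizedDerivOfComplex, norm_mul]
  refine mul_le_mul_of_nonneg_left ?_ (norm_nonneg _)
  have him {w : ℂ} (hw : w ∈ Metric.closedBall (z : ℂ) 1) : max A 0 + 1 ≤ w.im := by
    have h1 : |(w - z).im| ≤ 1 :=
      (Complex.abs_im_le_norm _).trans (by simpa [dist_eq_norm] using hw)
    have h2 := (abs_le.mp h1).1
    simp only [Complex.sub_im, coe_im] at h2
    linarith
  have hpos {w : ℂ} (hw : w ∈ Metric.closedBall (z : ℂ) 1) : 0 < w.im := by
    linarith [him hw, le_max_right A 0]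
  have hdiff : DiffContOnCl ℂ (f ∘ ofComplex) (Metric.ball (z : ℂ) 1) := by
    refine DifferentiableOn.diffContOnCl_ball (U := {w : ℂ | 0 < w.im})
      (UpperHalfPlane.mdifferentiable_iff.mp hf) fun w hw => hpos hw
  have := Complex.norm_deriv_le_of_forall_mem_sphere_norm_le one_pos hdiff (C := M) fun w hw => by
    have hw' := Metric.sphere_subset_closedBall hw
    rw [Function.comp_apply, ofComplex_apply_of_im_pos (hpos hw')]
    refine hA _ ?_
    change A ≤ w.im
    linarith [him hw', le_max_left A 0]
  simpa using this

/-- The Serre derivative of a modular form of level one. -/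
def serreForm {k : ℤ} (f : ModularForm 𝒮ℒ k) : ModularForm 𝒮ℒ (k + 2) where
  toFun := Derivative.serreDerivative k f
  slash_action_eq' := fun _ ⟨γ, hγ⟩ => hγ ▸
    Derivative.serreDerivative_slash_invariant f.holo' (f.slash_action_eq' _ ⟨γ, rfl⟩)
  holo' := Derivative.serreDerivative_mdifferentiable _ f.holo'
  bdd_at_cusps' {c} hc := by
    rw [Subgroup.IsArithmetic.isCusp_iff_isCusp_SL2Z] at hc
    rw [OnePoint.isBoundedAt_iff_forall_SL2Z hc]
    intro γ _
    have hinv : Derivative.serreDerivative (k : ℂ) f ∣[k + 2] γ =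
        Derivative.serreDerivative (k : ℂ) f :=
      Derivative.serreDerivative_slash_invariant f.holo' (f.slash_action_eq' _ ⟨γ, rfl⟩)
    rw [hinv]
    have hb : IsBoundedAtImInfty f := ModularFormClass.bdd_at_infty f
    have h2 : IsBoundedAtImInfty ((k * 12⁻¹ : ℂ) • (EisensteinSeries.E2 * ⇑f)) :=
      (EisensteinSeries.isBoundedAtImInfty_E2.mul hb).smul _
    have h3 := (isBoundedAtImInfty_normalizedDeriv f.holo' hb).add h2.neg
    have heq : Derivative.serreDerivative (k : ℂ) f =
        Derivative.normalizedDerivOfComplex f +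
          -((k * 12⁻¹ : ℂ) • (EisensteinSeries.E2 * ⇑f)) := by
      ext z
      simp
      ring
    exact heq ▸ h3

theorem delta_hom_ofModularForm {k : ℤ} (f : ModularForm 𝒮ℒ k) :
    delta (hom (ofModularForm f) k) = hom (ofModularForm (serreForm f)) ((k + 2 : ℤ) : ℝ) := by
  rw [delta_hom]
  push_cast
  congr 1

/-! ### Finiteness over a differential algebra. -/

section Differential

variable {K C : Type*} [Field K] [CommRing C] [Algebra K C]

/-- `x` is contained in a finitely generated `A`-submodule which is stable under `d`. -/
def IsDFinite (A : Subalgebra K C) (d : Module.End K C) (x : C) : Prop :=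
  ∃ M : Submodule A C, M.FG ∧ (∀ y ∈ M, d y ∈ M) ∧ x ∈ M

variable {A : Subalgebra K C} {d : Module.End K C}

theorem isDFinite_zero : IsDFinite A d 0 :=
  ⟨⊥, Submodule.fg_bot, by simp, zero_mem _⟩

theorem IsDFinite.add {x y : C} (hx : IsDFinite A d x) (hy : IsDFinite A d y) :
    IsDFinite A d (x + y) := by
  obtain ⟨M, hM, hMd, hxM⟩ := hx
  obtain ⟨N, hN, hNd, hyN⟩ := hy
  refine ⟨M ⊔ N, hM.sup hN, fun z hz => ?_, Submodule.add_mem_sup hxM hyN⟩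
  obtain ⟨u, hu, v, hv, rfl⟩ := Submodule.mem_sup.mp hz
  rw [map_add]
  exact Submodule.add_mem_sup (hMd u hu) (hNd v hv)

/-- By the Leibniz rule `M * N` is stable when `M` and `N` are. -/
theorem IsDFinite.mul (hd : ∀ x y, d (x * y) = d x * y + x * d y) {x y : C}
    (hx : IsDFinite A d x) (hy : IsDFinite A d y) : IsDFinite A d (x * y) := by
  obtain ⟨M, hM, hMd, hxM⟩ := hx
  obtain ⟨N, hN, hNd, hyN⟩ := hy
  refine ⟨M * N, hM.mul hN, fun z hz => ?_, Submodule.mul_mem_mul hxM hyN⟩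
  induction hz using Submodule.mul_induction_on' with
  | mem_mul_mem u hu v hv =>
    rw [hd]
    exact add_mem (Submodule.mul_mem_mul (hMd u hu) hv) (Submodule.mul_mem_mul hu (hNd v hv))
  | add u _ v _ hu hv =>
    rw [map_add]
    exact add_mem hu hv

theorem isDFinite_of_mem (hA : ∀ a ∈ A, d a ∈ A) {x : C} (hx : x ∈ A) : IsDFinite A d x := by
  have hmem (y : C) : y ∈ Submodule.span A {(1 : C)} ↔ y ∈ A := by
    rw [Submodule.mem_span_singleton]
    exact ⟨fun ⟨a, ha⟩ => by simp [← ha, Subalgebra.smul_def],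
      fun hy => ⟨⟨y, hy⟩, by simp [Subalgebra.smul_def]⟩⟩
  exact ⟨_, Submodule.fg_span_singleton _, fun y hy => (hmem _).2 (hA y ((hmem y).1 hy)),
    (hmem x).2 hx⟩

/-- Solutions of monic linear differential equations over `A` are `d`-finite. -/
theorem isDFinite_of_equation (hd : ∀ x y, d (x * y) = d x * y + x * d y)
    (hA : ∀ a ∈ A, d a ∈ A) {x : C} {n : ℕ} (c : Fin n → A)
    (h : (d ^ n) x + ∑ i : Fin n, (c i : C) * (d ^ (i : ℕ)) x = 0) : IsDFinite A d x := by
  set M : Submodule A C := Submodule.span A (Set.range fun i : Fin n => (d ^ (i : ℕ)) x)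
  have hmem (i : Fin n) : (d ^ (i : ℕ)) x ∈ M := Submodule.subset_span ⟨i, rfl⟩
  have hn : (d ^ n) x ∈ M := by
    rw [eq_neg_of_add_eq_zero_left h]
    exact neg_mem (sum_mem fun i _ => M.smul_mem (c i) (hmem i))
  -- Including `i = n` covers `n = 0`, where the equation says `x = 0`.
  have hle {i : ℕ} (hi : i ≤ n) : (d ^ i) x ∈ M := by
    rcases hi.lt_or_eq with hi | rfl
    · exact hmem ⟨i, hi⟩
    · exact hn
  refine ⟨M, Submodule.fg_span (Set.finite_range _), fun y hy => ?_, by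
    simpa using hle (Nat.zero_le n)⟩
  induction hy using Submodule.span_induction with
  | mem y hy =>
    obtain ⟨i, rfl⟩ := hy
    have := hle (Nat.succ_le_of_lt i.2)
    rwa [Nat.succ_eq_add_one, pow_succ', Module.End.mul_apply] at this
  | zero => simp
  | add y z _ _ hy hz =>
    rw [map_add]
    exact add_mem hy hz
  | smul a y hyM hy =>
    rw [Subalgebra.smul_def, smul_eq_mul, hd]
    exact add_mem (M.smul_mem ⟨d a, hA a a.2⟩ hyM) (M.smul_mem a hy)

/-- Over a finitely generated algebra `A`, every `d`-finite element solves a monic equation. -/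
theorem IsDFinite.exists_equation (hfg : A.FG) {x : C} (hx : IsDFinite A d x) :
    ∃ (n : ℕ) (c : Fin n → A), (d ^ n) x + ∑ i : Fin n, (c i : C) * (d ^ (i : ℕ)) x = 0 := by
  obtain ⟨M, hM, hMd, hxM⟩ := hx
  have : Algebra.FiniteType K A := A.fg_iff_finiteType.mp hfg
  have : IsNoetherianRing A := Algebra.FiniteType.isNoetherianRing K A
  have : IsNoetherian A M := isNoetherian_of_fg_of_noetherian M hM
  have hpow (i : ℕ) : (d ^ i) x ∈ M := by
    induction i with
    | zero => simpa using hxM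
    | succ i ih =>
      rw [pow_succ', Module.End.mul_apply]
      exact hMd _ ih
  -- The spans of the first `n` derivatives form an ascending chain in a Noetherian module; where it
  -- stabilizes, the next derivative yields the equation.
  let F : ℕ →o Submodule A M :=
    { toFun := fun n => Submodule.span A
        (Set.range fun i : Fin n => (⟨(d ^ (i : ℕ)) x, hpow i⟩ : M))
      monotone' := fun m n hmn => Submodule.span_mono <| by
        rintro _ ⟨i, rfl⟩
        exact ⟨Fin.castLE hmn i, rfl⟩ }
  obtain ⟨n, hn⟩ := monotone_stabilizes_iff_noetherian.mpr ‹IsNoetherian A M› F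
  have h1 : (⟨(d ^ n) x, hpow n⟩ : M) ∈ F (n + 1) :=
    Submodule.subset_span ⟨Fin.last n, rfl⟩
  rw [← hn (n + 1) n.le_succ] at h1
  obtain ⟨c, hc⟩ := (Submodule.mem_span_range_iff_exists_fun A).mp h1
  refine ⟨n, fun i => -c i, ?_⟩
  have hc' := congrArg (Subtype.val : M → C) hc
  simp only [Submodule.coe_sum, Submodule.coe_smul, Subalgebra.smul_def, smul_eq_mul] at hc'
  simp [← hc']

end Differential

/-! ### Application to `H`. -/

/-- The `E₂` term of the Serre derivative is linear in the weight, and weights add under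
multiplication. -/
theorem delta_mul (φ ψ : H) : delta (φ * ψ) = delta φ * ψ + φ * delta ψ := by
  induction φ using AddMonoidAlgebra.induction_linear with
  | zero => simp
  | add φ₁ φ₂ h₁ h₂ =>
    rw [add_mul, map_add, map_add, h₁, h₂, add_mul, add_mul]
    abel
  | single m f =>
    induction ψ using AddMonoidAlgebra.induction_linear with
    | zero => simp
    | add ψ₁ ψ₂ h₁ h₂ =>
      rw [mul_add, map_add, map_add, h₁, h₂, mul_add, mul_add]
      abel
    | single n g =>
      change delta (hom f m * hom g n) = delta (hom f m) * hom g n + hom f m * delta (hom g n)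
      rw [hom_mul_hom, delta_hom, delta_hom, delta_hom, hom_mul_hom, hom_mul_hom,
        show m + n + 2 = m + 2 + n by ring, show m + (n + 2) = m + 2 + n by ring, ← hom_add]
      congr 1
      refine Subtype.ext ?_
      have := Derivative.serreDerivative_mul (m : ℂ) (n : ℂ) f.1 g.1 f.2 g.2
      rw [← Complex.ofReal_add] at this
      exact this

/-- On generators, the Serre derivative is again a modular form, hence a polynomial in `E₄` and
`E₆`; Ramanujan's explicit formulas are not needed. -/
theorem delta_mem_formAlg {φ : H} (hφ : φ ∈ formAlg) : delta φ ∈ formAlg := by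
  induction hφ using Algebra.adjoin_induction with
  | mem φ hφ =>
    rcases hφ with rfl | rfl
    · rw [show (4 : ℝ) = ((4 : ℤ) : ℝ) by norm_num, delta_hom_ofModularForm]
      exact hom_mem_formAlg _
    · rw [show (6 : ℝ) = ((6 : ℤ) : ℝ) by norm_num, delta_hom_ofModularForm]
      exact hom_mem_formAlg _
  | algebraMap c =>
    have h1 : delta (1 : H) = 0 := by
      have h := delta_mul 1 1
      rw [mul_one, mul_one, one_mul] at h
      simpa using h
    rw [Algebra.algebraMap_eq_smul_one, map_smul, h1, smul_zero]
    exact zero_mem _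
  | add φ ψ _ _ hφ hψ =>
    rw [map_add]
    exact add_mem hφ hψ
  | mul φ ψ hφ' hψ' hφ hψ =>
    rw [delta_mul]
    exact add_mem (mul_mem hφ hψ') (mul_mem hφ' hψ)

theorem formAlg_fg : formAlg.FG :=
  Subalgebra.fg_def.mpr ⟨_, Set.toFinite _, rfl⟩

theorem map_lmul_formAlg : formAlg.map (Algebra.lmul ℂ H) = coeffAlg := by
  rw [formAlg, AlgHom.map_adjoin, Set.image_pair]
  rfl

theorem coeffAlg_le_R : coeffAlg ≤ R := Algebra.adjoin_mono (by simp)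

theorem mem_S_iff {k : ℝ} {φ : H} : φ ∈ S k ↔ φ ∈ degH k ∧ IsDFinite formAlg delta φ := by
  refine and_congr_right fun _ => ⟨?_, fun h => ?_⟩
  · rintro ⟨a, _, ⟨n, c, rfl⟩, ha⟩
    have hc (i : Fin n) : ∃ b : formAlg, Algebra.lmul ℂ H b = c i := by
      obtain ⟨b, hb, hbc⟩ := map_lmul_formAlg.ge (c i).2
      exact ⟨⟨b, hb⟩, hbc⟩
    choose b hb using hc
    refine isDFinite_of_equation delta_mul (fun _ => delta_mem_formAlg) b ?_
    rw [← ha]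
    simp [← hb]
  · obtain ⟨n, b, hb⟩ := h.exists_equation formAlg_fg
    have hc (i : Fin n) : Algebra.lmul ℂ H (b i) ∈ coeffAlg := by
      rw [← map_lmul_formAlg]
      exact ⟨b i, (b i).2, rfl⟩
    have hdelta : delta ∈ R := Algebra.subset_adjoin (by simp)
    refine ⟨_, add_mem (pow_mem hdelta n) (sum_mem fun i _ =>
      mul_mem (coeffAlg_le_R (hc i)) (pow_mem hdelta i)), ⟨n, fun i => ⟨_, hc i⟩, rfl⟩, ?_⟩
    rw [← hb]
    simp

/-- The same module `M` works for `a φ`: it is stable under `delta` and, as a `formAlg`-module,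
under `e4` and `e6`. -/
theorem isDFinite_of_mem_R {a : Module.End ℂ H} (ha : a ∈ R) {φ : H}
    (hφ : IsDFinite formAlg delta φ) : IsDFinite formAlg delta (a φ) := by
  obtain ⟨M, hM, hMd, hφM⟩ := hφ
  refine ⟨M, hM, hMd, ?_⟩
  induction ha using Algebra.adjoin_induction generalizing φ with
  | mem a ha =>
    rcases ha with rfl | rfl | rfl
    · exact hMd φ hφM
    · exact M.smul_mem ⟨_, hom_E₄_mem⟩ hφM
    · exact M.smul_mem ⟨_, hom_E₆_mem⟩ hφM
  | algebraMap c =>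
    rw [Module.algebraMap_end_apply, ← algebraMap_smul formAlg]
    exact M.smul_mem _ hφM
  | add a b _ _ ha hb => exact add_mem (ha hφM) (hb hφM)
  | mul a b _ _ ha hb => exact ha (hb hφM)

/-! ### Closure properties of `S` and of the direct sum. -/

theorem add_mem_S {k : ℝ} {φ ψ : H} (hφ : φ ∈ S k) (hψ : ψ ∈ S k) : φ + ψ ∈ S k := by
  rw [mem_S_iff] at *
  obtain ⟨⟨f, rfl⟩, hf⟩ := hφ
  obtain ⟨⟨g, rfl⟩, hg⟩ := hψ
  exact ⟨⟨f + g, hom_add f g k⟩, hf.add hg⟩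

theorem mul_mem_S {k l : ℝ} {φ ψ : H} (hφ : φ ∈ S k) (hψ : ψ ∈ S l) : φ * ψ ∈ S (k + l) := by
  rw [mem_S_iff] at *
  obtain ⟨⟨f, rfl⟩, hf⟩ := hφ
  obtain ⟨⟨g, rfl⟩, hg⟩ := hψ
  exact ⟨⟨f * g, (hom_mul_hom f g k l).symm⟩, hf.mul delta_mul hg⟩

theorem apply_mem_S {k : ℤ} {l : ℝ} {a : Module.End ℂ H} (ha : a ∈ degR k) {φ : H}
    (hφ : φ ∈ S l) : a φ ∈ S (k + l) := by
  rw [mem_S_iff] at *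
  rw [add_comm]
  exact ⟨ha.2 l φ hφ.1, isDFinite_of_mem_R ha.1 hφ.2⟩

theorem modularForms_subset_S (k : ℤ) : modularForms k ⊆ S k := by
  rintro _ ⟨f, rfl⟩
  exact mem_S_iff.mpr ⟨⟨_, rfl⟩, isDFinite_of_mem (fun _ => delta_mem_formAlg) (hom_mem_formAlg f)⟩

theorem zero_mem_S (k : ℝ) : (0 : H) ∈ S k :=
  mem_S_iff.mpr ⟨⟨0, AddMonoidAlgebra.single_zero _⟩, isDFinite_zero⟩

/-- The additive monoid underlying `⨁ S_k`. -/
def sumSAddSubmonoid : AddSubmonoid H where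
  carrier := sumS
  zero_mem' k := by simpa using zero_mem_S k
  add_mem' {φ ψ} hφ hψ k := by
    rw [AddMonoidAlgebra.coeff_add, Finsupp.add_apply, hom_add]
    exact add_mem_S (hφ k) (hψ k)

theorem mem_sumS_of_mem_S {k : ℝ} {φ : H} (hφ : φ ∈ S k) : φ ∈ sumSAddSubmonoid := by
  obtain ⟨⟨f, rfl⟩, _⟩ := id hφ
  intro l
  by_cases h : l = k
  · subst h
    simpa using hφ
  · simpa [AddMonoidAlgebra.coeff_single, Finsupp.single_apply, Ne.symm h] using zero_mem_S l

theorem sumS_induction {p : H → Prop} (zero : p 0) (add : ∀ φ ψ, p φ → p ψ → p (φ + ψ))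
    (mem : ∀ k, ∀ φ ∈ S k, p φ) {φ : H} (hφ : φ ∈ sumSAddSubmonoid) : p φ := by
  rw [← AddMonoidAlgebra.sum_coeff_single φ]
  exact Finset.sum_induction _ p add zero fun k _ => mem k _ (hφ k)

theorem mul_mem_sumS {φ ψ : H} (hφ : φ ∈ sumSAddSubmonoid) (hψ : ψ ∈ sumSAddSubmonoid) :
    φ * ψ ∈ sumSAddSubmonoid := by
  refine sumS_induction (p := fun φ => φ * ψ ∈ sumSAddSubmonoid) (by simp)
    (fun φ₁ φ₂ h₁ h₂ => ?_) (fun k φ hφ => ?_) hφ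
  · rw [add_mul]
    exact add_mem h₁ h₂
  · refine sumS_induction (p := fun ψ => φ * ψ ∈ sumSAddSubmonoid) (by simp)
      (fun ψ₁ ψ₂ h₁ h₂ => ?_) (fun l ψ hψ => ?_) hψ
    · rw [mul_add]
      exact add_mem h₁ h₂
    · exact mem_sumS_of_mem_S (mul_mem_S hφ hψ)

theorem algebraMap_mem_sumS (c : ℂ) : algebraMap ℂ H c ∈ sumSAddSubmonoid :=
  mem_sumS_of_mem_S <| mem_S_iff.mpr
    ⟨⟨_, (algebraMap_eq_hom c).symm⟩,
      isDFinite_of_mem (fun _ => delta_mem_formAlg) (formAlg.algebraMap_mem c)⟩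

theorem delta_mem_degR : delta ∈ degR 2 := by
  refine ⟨Algebra.subset_adjoin (by simp), ?_⟩
  rintro n _ ⟨f, rfl⟩
  exact ⟨_, (delta_hom f n).symm⟩

theorem apply_mem_sumS {a : Module.End ℂ H} (ha : a ∈ R) {φ : H} (hφ : φ ∈ sumSAddSubmonoid) :
    a φ ∈ sumSAddSubmonoid := by
  -- This reduces `e4` and `e6` to closure under products, leaving only `delta` to check by weights.
  have hE {k : ℤ} (f : ModularForm 𝒮ℒ k) : hom (ofModularForm f) k ∈ sumSAddSubmonoid :=
    mem_sumS_of_mem_S (modularForms_subset_S k ⟨f, rfl⟩)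
  induction ha using Algebra.adjoin_induction generalizing φ with
  | mem a ha =>
    rcases ha with rfl | rfl | rfl
    · refine sumS_induction (p := fun φ => delta φ ∈ sumSAddSubmonoid) (by simp)
        (fun φ₁ φ₂ h₁ h₂ => ?_) (fun k φ hφ => ?_) hφ
      · rw [map_add]
        exact add_mem h₁ h₂
      · exact mem_sumS_of_mem_S (apply_mem_S delta_mem_degR hφ)
    · exact mul_mem_sumS (by simpa using hE ModularForm.E₄) hφ
    · exact mul_mem_sumS (by simpa using hE ModularForm.E₆) hφ
  | algebraMap c =>
    rw [Module.algebraMap_end_apply, Algebra.smul_def]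
    exact mul_mem_sumS (algebraMap_mem_sumS c) hφ
  | add a b _ _ ha hb => exact add_mem (ha hφ) (hb hφ)
  | mul a b _ _ ha hb => exact ha (hb hφ)

end MLDO

end

theorem mainTheorem6 :
    (∀ k : ℝ, MLDO.S k + MLDO.S k ⊆ MLDO.S k) ∧
    (∀ k l : ℝ, MLDO.S k * MLDO.S l ⊆ MLDO.S (k + l)) ∧
    (∀ (k : ℤ) (l : ℝ), ∀ a ∈ MLDO.degR k, ∀ φ ∈ MLDO.S l, a φ ∈ MLDO.S (k + l)) ∧
    (∀ k : ℤ, MLDO.modularForms k ⊆ MLDO.S k) ∧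
    (∃ A : Subalgebra ℂ MLDO.H, (A : Set MLDO.H) = MLDO.sumS) ∧
    (∃ N : Submodule MLDO.R MLDO.H, (N : Set MLDO.H) = MLDO.sumS) := by
  refine ⟨?_, ?_, fun k l a ha φ hφ => MLDO.apply_mem_S ha hφ, MLDO.modularForms_subset_S,
    ⟨{ MLDO.sumSAddSubmonoid with
        mul_mem' := MLDO.mul_mem_sumS
        algebraMap_mem' := MLDO.algebraMap_mem_sumS }, rfl⟩,
    ⟨{ MLDO.sumSAddSubmonoid with
        smul_mem' := fun a _ hφ => MLDO.apply_mem_sumS a.2 hφ }, rfl⟩⟩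
  · rintro k _ ⟨φ, hφ, ψ, hψ, rfl⟩
    exact MLDO.add_mem_S hφ hψ
  · rintro k l _ ⟨φ, hφ, ψ, hψ, rfl⟩
    exact MLDO.mul_mem_S hφ hψ
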